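/- Let $\mathcal H^0$ be a real Hilbert space, $\mathcal H^1$ a real Banach space (in particular, it may be a Hilbert space) and $\mathcal B$ a real normed space, with linear inclusions $\mathcal H^1\subset\mathcal B\subset\mathcal H^0$ such that $\mathcal H^1$ and $\mathcal B$ are dense in $\mathcal H^0$, $\mathcal B\to\mathcal H^0$ is continuous and $\mathcal H^1\to\mathcal B$ is compact. An element $h\in\mathcal H^0$ is identified with the functional $g\mapsto\langle h,g\rangle_{\mathcal H^0}$ on $\mathcal H^1$; we write $\langle F,g\rangle$ also for the value at $g$ of a functional $F\in(\mathcal H^1)^*$, and all equations below are equations in $(\mathcal H^1)^*$. Let $L=L_1+L_2$ with $L_1:\mathcal H^1\to(\mathcal H^1)^*$ and $L_2:\mathcal H^0\to\mathcal H^0$ linear, let $N:\mathcal H^1\to(\mathcal H^1)^*$ be a map and $\mathrm E\in\mathcal H^0$. Let $J$ be defined on the affine space $\overline w+\mathcal H^1$, with values in $(\mathcal H^1)^*$, and suppose $J(\overline w+w)=Lw+N(w)+\mathrm E$ for all $w\in\mathcal H^1$. Here $A\lesssim B$ means $A\le CB$ with a constant $C$ independent of the functions involved. Assume the following. (1) There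 are constants $K_0,K_1,K_2>0$ with $\|f\|_{\mathcal H^0}\le K_0\|f\|_{\mathcal H^1}$, $\langle L_1f,f\rangle\ge K_1\|f\|_{\mathcal H^1}^2$ and $|\langle L_1f,g\rangle|\lesssim\|f\|_{\mathcal H^1}\|g\|_{\mathcal H^1}$ for all $f,g\in\mathcal H^1$, and $\|L_2f\|_{\mathcal H^0}\le K_2\|f\|_{\mathcal H^0}$ for all $f\in\mathcal H^0$. (2) For some $n$ there are a linear map $S=(s_1,\dots,s_n):\mathcal H^1\to\mathbb R^n$ and elements $\psi_i,r_i\in\mathcal H^0$, $\phi_i\in\mathcal H^1$ ($1\le i\le n$) with $L\phi_i=-L_2\psi_i+r_i$ for every $i$, and real constants $\delta_1$, $\varepsilon_1$, $\gamma_1\ge0$, $\gamma_2$ such that, with $I_nf:=\sum_js_j(f)\psi_j$, for all $f\in\mathcal H^1$, $$\|I_nf-f\|_{\mathcal H^0}\le\delta_1\|f\|_{\mathcal H^1},\quad|S(f)|\lesssim\|f\|_{\mathcal H^0},\quad|S(f)|\le\gamma_1\|f\|_{\mathcal H^1},$$ $$\Big(\sum_i\|r_i\|_{\mathcal H^0}^2\Big)^{1/2}\le\varepsilon_1,\qquad\Big(\sum_i\|\phi_i\|_{\mathcal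 H^1}^2\Big)^{1/2}\le\gamma_2,$$ where $|\cdot|$ is the Euclidean norm on $\mathbb R^n$. (3) $\|\mathrm E\|_{\mathcal H^0}\le\varepsilon_2$. (4) There is a constant $K_3>0$ such that for all $u,w,u_1,u_2,w_1,w_2\in\mathcal H^1$, $|\langle N(u),w\rangle|\le K_3\|u\|_{\mathcal H^1}^2\|w\|_{\mathcal H^1}$ and $$|\langle N(u_1)-N(u_2),w_1-w_2\rangle|\lesssim(\|u_1\|_{\mathcal H^1}+\|u_2\|_{\mathcal H^1})\|u_1-u_2\|_{\mathcal B}\|w_1-w_2\|_{\mathcal B}.$$ Suppose moreover that $a:=K_1-K_0K_2\delta_1-K_0\gamma_1\varepsilon_1>0$ and $M_4:=a^2-4\varepsilon_2K_0K_3(1+\gamma_1\gamma_2)^2\ge0$, and put $$x^w:=\frac{a-\sqrt{M_4}}{2K_3(1+\gamma_1\gamma_2)^2}.$$ Let $L_{\mathrm{ap}}f:=\sum_js_j(f)(L_2\psi_j-r_j)$, $L_{\mathrm{res}}:=L_2-L_{\mathrm{ap}}$ and $Gf:=\sum_js_j(f)\phi_j$. Then there is $w_1\in\mathcal H^1$ with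 $\|w_1\|_{\mathcal H^1}\le x^w$ which, together with $w_2:=Gw_1$, solves $$L_1w_1+L_{\mathrm{res}}w_1=-\mathrm E-N(w_1+w_2),\qquad Lw_2=-L_{\mathrm{ap}}w_1.$$ Consequently $w:=w_1+w_2$ solves $Lw+N(w)+\mathrm E=0$, and $\widetilde w:=\overline w+w$ is a solution of $J(\widetilde w)=0$ with $\|\overline w-\widetilde w\|_{\mathcal H^1}\le(1+\gamma_1\gamma_2)x^w$. -/

import Mathlib

open scoped BigOperators

namespace AbstractExistence

noncomputable section

/-! Throughout, `H0`, `H1`, `B` are real normed spaces, `ι : H1 → B` and `κ : B → H0` are the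
inclusions `H1 ⊂ B ⊂ H0`.  The pairing `⟨F, g⟩` of `H0` is extended to functionals `F` in the dual
of `H1`, so that operators such as the Laplacian, which map `H1` into its dual, are covered;
equations are equations in the dual of `H1` (tested against every element of `H1`). -/

section Operators

variable {H0 H1 B : Type*}
  [NormedAddCommGroup H0] [InnerProductSpace ℝ H0]
  [NormedAddCommGroup H1] [NormedSpace ℝ H1]
  [NormedAddCommGroup B] [NormedSpace ℝ B]

/-- An element `h` of `H0`, seen as the functional `g ↦ ⟨h, g⟩_{H0}` on `H1`. -/
def toDual (ι : H1 →L[ℝ] B) (κ : B →L[ℝ] H0) (h : H0) : StrongDual ℝ H1 :=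
  (innerSL ℝ h).comp (κ.comp ι)

/-- The operator `L = L₁ + L₂`, as a map from `H1` to its dual. -/
def fullOp (ι : H1 →L[ℝ] B) (κ : B →L[ℝ] H0) (L₁ : H1 →ₗ[ℝ] StrongDual ℝ H1) (L₂ : H0 →ₗ[ℝ] H0)
    (w : H1) : StrongDual ℝ H1 :=
  L₁ w + toDual ι κ (L₂ (κ (ι w)))

variable {n : ℕ}

/-- The interpolation operator `I_n f = ∑ⱼ sⱼ(f) ψⱼ`. -/
def interp (S : H1 →ₗ[ℝ] EuclideanSpace ℝ (Fin n)) (ψ : Fin n → H0) (f : H1) : H0 :=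
  ∑ j, S f j • ψ j

/-- The finite-rank operator `L_ap f = ∑ⱼ sⱼ(f) (L₂ ψⱼ - rⱼ)`. -/
def finiteRankOp (L₂ : H0 →ₗ[ℝ] H0) (S : H1 →ₗ[ℝ] EuclideanSpace ℝ (Fin n)) (ψ r : Fin n → H0)
    (f : H1) : H0 :=
  ∑ j, S f j • (L₂ (ψ j) - r j)

/-- The remainder `L_res = L₂ - L_ap`. -/
def residualOp (ι : H1 →L[ℝ] B) (κ : B →L[ℝ] H0) (L₂ : H0 →ₗ[ℝ] H0)
    (S : H1 →ₗ[ℝ] EuclideanSpace ℝ (Fin n)) (ψ r : Fin n → H0) (f : H1) : H0 :=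
  L₂ (κ (ι f)) - finiteRankOp L₂ S ψ r f

/-- The operator `G f = ∑ⱼ sⱼ(f) φⱼ`. -/
def correction (S : H1 →ₗ[ℝ] EuclideanSpace ℝ (Fin n)) (φ : Fin n → H1) (f : H1) : H1 :=
  ∑ j, S f j • φ j

/-- The a priori bounds on the spaces and on the linear operator.  Continuity of `κ` is the bound
`‖f‖_{H0} ≲ ‖f‖_B`. -/
structure AprioriBounds (ι : H1 →L[ℝ] B) (κ : B →L[ℝ] H0) (L₁ : H1 →ₗ[ℝ] StrongDual ℝ H1)
    (L₂ : H0 →ₗ[ℝ] H0) (K₀ K₁ K₂ : ℝ) : Prop where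
  injective_ι : Function.Injective ι
  injective_κ : Function.Injective κ
  dense_H1 : DenseRange (fun f : H1 => κ (ι f))
  dense_B : DenseRange κ
  compact_ι : IsCompactOperator ι
  K₀_pos : 0 < K₀
  K₁_pos : 0 < K₁
  K₂_pos : 0 < K₂
  embed : ∀ f : H1, ‖κ (ι f)‖ ≤ K₀ * ‖f‖
  coercive : ∀ f : H1, K₁ * ‖f‖ ^ 2 ≤ L₁ f f
  bounded : ∃ C : ℝ, ∀ f g : H1, |L₁ f g| ≤ C * ‖f‖ * ‖g‖
  L₂_bound : ∀ f : H0, ‖L₂ f‖ ≤ K₂ * ‖f‖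

/-- The finite-rank approximation: interpolation error `δ₁`, approximate solutions `φᵢ` of
`L φᵢ = -L₂ ψᵢ` with residuals `rᵢ`, and bounds on the coefficients `S` and on `Φ`. -/
structure FiniteRankApproximation (ι : H1 →L[ℝ] B) (κ : B →L[ℝ] H0)
    (L₁ : H1 →ₗ[ℝ] StrongDual ℝ H1) (L₂ : H0 →ₗ[ℝ] H0)
    (S : H1 →ₗ[ℝ] EuclideanSpace ℝ (Fin n)) (ψ : Fin n → H0) (φ : Fin n → H1) (r : Fin n → H0)
    (δ₁ ε₁ γ₁ γ₂ : ℝ) : Prop where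
  interp_error : ∀ f : H1, ‖interp S ψ f - κ (ι f)‖ ≤ δ₁ * ‖f‖
  solves : ∀ i, fullOp ι κ L₁ L₂ (φ i) = toDual ι κ (-L₂ (ψ i) + r i)
  residual : √(∑ i, ‖r i‖ ^ 2) ≤ ε₁
  S_bound_H0 : ∃ C : ℝ, ∀ f : H1, ‖S f‖ ≤ C * ‖κ (ι f)‖
  γ₁_nonneg : 0 ≤ γ₁
  S_bound_H1 : ∀ f : H1, ‖S f‖ ≤ γ₁ * ‖f‖
  Φ_bound : √(∑ i, ‖φ i‖ ^ 2) ≤ γ₂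

/-- The quadratic bound and the continuity estimate for the nonlinear term; `N u w` is
`⟨N(u), w⟩_{H0}`. -/
structure NonlinearEstimate (ι : H1 →L[ℝ] B) (N : H1 → StrongDual ℝ H1) (K₃ : ℝ) : Prop where
  K₃_pos : 0 < K₃
  quadratic : ∀ u w : H1, |N u w| ≤ K₃ * ‖u‖ ^ 2 * ‖w‖
  continuity : ∃ C : ℝ, ∀ u₁ u₂ w₁ w₂ : H1,
    |(N u₁ - N u₂) (w₁ - w₂)| ≤ C * (‖u₁‖ + ‖u₂‖) * ‖ι u₁ - ι u₂‖ * ‖ι w₁ - ι w₂‖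

end Operators

/-- The coercivity constant `K₁ - K₀ K₂ δ₁ - K₀ γ₁ ε₁` of `L₁ + L_res`. -/
def coercConst (K₀ K₁ K₂ δ₁ ε₁ γ₁ : ℝ) : ℝ :=
  K₁ - K₀ * K₂ * δ₁ - K₀ * γ₁ * ε₁

/-- The discriminant `M₄`. -/
def M₄ (K₀ K₁ K₂ K₃ δ₁ ε₁ ε₂ γ₁ γ₂ : ℝ) : ℝ :=
  coercConst K₀ K₁ K₂ δ₁ ε₁ γ₁ ^ 2 - 4 * ε₂ * K₀ * K₃ * (1 + γ₁ * γ₂) ^ 2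

/-- The radius `x^w`. -/
def radius (K₀ K₁ K₂ K₃ δ₁ ε₁ ε₂ γ₁ γ₂ : ℝ) : ℝ :=
  (coercConst K₀ K₁ K₂ δ₁ ε₁ γ₁ - √(M₄ K₀ K₁ K₂ K₃ δ₁ ε₁ ε₂ γ₁ γ₂)) /
    (2 * K₃ * (1 + γ₁ * γ₂) ^ 2)

end

end AbstractExistence

/-!
Since `L (G w₁) = -L_ap w₁`, the whole system reduces to one equation for `w₁`,
`(L₁ + L_res) w₁ = -E - N (w₁ + G w₁)`. The norm of `L_res` is controlled by the interpolation
error and the residuals, so that `L₁ + L_res` is coercive with constant `a = coercConst`. A coercive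
bounded form makes the Banach space `H1` isomorphic to a Hilbert space (`exists_hilbert_equiv`), and
Lax-Milgram (`exists_eq_of_coercive`) defines `T u` as the solution of
`(L₁ + L_res) (T u) = -E - N (u + G u)`.

Coercivity and the quadratic bound on `N` give `a ‖T u‖ ≤ ε₂ K₀ + K₃ (1 + γ₁ γ₂)² R²` for
`‖u‖ ≤ R`, and `radius` is the smaller root `R` of the equation that makes the right-hand side
`a R`; so `T` maps the ball of that radius to itself. Coercivity and the continuity estimate for `N`
give `‖T u - T v‖_{H1} ≲ ‖u - v‖_B`, and `H1 → B` is compact, so `T` is Lipschitz with totally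
bounded range on the ball. Schauder's theorem (`exists_fixedPoint_of_totallyBounded`,
`exists_fixedPoint_of_compact`) gives a fixed point, which is `w₁` (`exists_mainOp_eq`).

Because `T` is Lipschitz, Schauder's theorem is needed for Lipschitz maps only, and follows by
orthogonal projection to finite-dimensional subspaces from Brouwer's theorem for Lipschitz maps
(`exists_fixedPoint_of_bounded`). The latter is proved by the Milnor-Rogers volume argument. A map
without fixed points yields a Lipschitz map `id + g` that retracts a ball onto its boundary sphere,
where `g` vanishes outside the ball (`not_forall_norm_add_eq`). For small `t ≥ 0` the map
`id + t g` permutes the ball, so `∫ det (1 + t Dg)` over the ball is its volume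
(`integral_det_one_add_smul_fderiv`). The determinant is a polynomial in `t` of bounded degree, so
by Lagrange interpolation the same holds for `t = 1`; but there the determinant vanishes almost
everywhere, because `id + g` has constant norm on the ball. Rademacher's theorem makes this work
without smoothness, and the Hausdorff measure of dimension `dim V` serves as Lebesgue measure.
-/

namespace AbstractExistence

open MeasureTheory Module Metric
open scoped NNReal

/-! ### Radial retractions -/

section RadialRetraction

variable {E : Type*} [NormedAddCommGroup E] [NormedSpace ℝ E]

/-- The radial retraction of `E` onto the closed ball of radius `c > 0` around `0`. -/
noncomputable def radialRetract (c : ℝ) (x : E) : E := (c / max c ‖x‖) • x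

lemma radialRetract_of_norm_le {c : ℝ} (hc : 0 < c) {x : E} (hx : ‖x‖ ≤ c) :
    radialRetract c x = x := by
  rw [radialRetract, max_eq_left hx, div_self hc.ne', one_smul]

lemma norm_radialRetract_of_le_norm {c : ℝ} (hc : 0 < c) {x : E} (hx : c ≤ ‖x‖) :
    ‖radialRetract c x‖ = c := by
  have : 0 < ‖x‖ := hc.trans_le hx
  rw [radialRetract, max_eq_right hx, norm_smul, Real.norm_of_nonneg (by positivity)]
  field_simp

lemma norm_radialRetract_le {c : ℝ} (hc : 0 < c) (x : E) : ‖radialRetract c x‖ ≤ c := by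
  rcases le_total ‖x‖ c with h | h
  · rwa [radialRetract_of_norm_le hc h]
  · exact (norm_radialRetract_of_le_norm hc h).le

lemma lipschitzWith_radialRetract {c : ℝ} (hc : 0 < c) :
    LipschitzWith 2 (radialRetract c : E → E) := by
  refine LipschitzWith.of_dist_le_mul fun x y => ?_
  rw [dist_eq_norm, dist_eq_norm]
  have hx : 0 < max c ‖x‖ := lt_max_of_lt_left hc
  have hy : 0 < max c ‖y‖ := lt_max_of_lt_left hc
  have hsplit : radialRetract c x - radialRetract c y
      = (c / max c ‖x‖) • (x - y) + (c / max c ‖x‖ - c / max c ‖y‖) • y := by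
    simp only [radialRetract, smul_sub, sub_smul]; abel
  have h1 : ‖(c / max c ‖x‖) • (x - y)‖ ≤ ‖x - y‖ := by
    rw [norm_smul, Real.norm_of_nonneg (by positivity)]
    exact mul_le_of_le_one_left (norm_nonneg _) ((div_le_one hx).2 (le_max_left _ _))
  have h2 : ‖(c / max c ‖x‖ - c / max c ‖y‖) • y‖ ≤ ‖x - y‖ := by
    have e : c / max c ‖x‖ - c / max c ‖y‖
        = c / max c ‖x‖ * ((max c ‖y‖ - max c ‖x‖) / max c ‖y‖) := by
      field_simp
    rw [norm_smul, e, norm_mul, Real.norm_of_nonneg (by positivity : 0 ≤ c / max c ‖x‖), norm_div,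
      Real.norm_of_nonneg hy.le, Real.norm_eq_abs]
    have h3 : |max c ‖y‖ - max c ‖x‖| ≤ ‖x - y‖ := by
      have := abs_max_sub_max_le_max c ‖y‖ c ‖x‖
      rw [sub_self, abs_zero, max_eq_right (abs_nonneg (‖y‖ - ‖x‖))] at this
      exact this.trans ((abs_norm_sub_norm_le y x).trans_eq (norm_sub_rev y x))
    calc c / max c ‖x‖ * (|max c ‖y‖ - max c ‖x‖| / max c ‖y‖) * ‖y‖
        = c / max c ‖x‖ * (|max c ‖y‖ - max c ‖x‖| * (‖y‖ / max c ‖y‖)) := by ring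
      _ ≤ 1 * (‖x - y‖ * 1) := by
          gcongr
          · exact (div_le_one hx).2 (le_max_left _ _)
          · exact (div_le_one hy).2 (le_max_right _ _)
      _ = ‖x - y‖ := by ring
  rw [hsplit]
  calc _ ≤ _ := norm_add_le _ _
    _ ≤ ‖x - y‖ + ‖x - y‖ := add_le_add h1 h2
    _ = _ := by norm_num; ring

end RadialRetraction

/-! ### The determinant of `1 + t A` -/

section Determinant

variable {V : Type*} [NormedAddCommGroup V] [NormedSpace ℝ V] [FiniteDimensional ℝ V]

lemma exists_polynomial_det_one_add_smul (A : V →L[ℝ] V) :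
    ∃ P : Polynomial ℝ, P.natDegree ≤ finrank ℝ V ∧ ∀ s : ℝ, P.eval s = (1 + s • A).det := by
  classical
  let b := finBasis ℝ V
  let M := LinearMap.toMatrix b b (A : V →ₗ[ℝ] V)
  refine ⟨((Polynomial.X : Polynomial ℝ) • M.map Polynomial.C
    + (1 : Matrix _ _ ℝ).map Polynomial.C).det, ?_, fun s => ?_⟩
  · simpa using Polynomial.natDegree_det_X_add_C_le M 1
  · rw [ContinuousLinearMap.det, ← LinearMap.det_toMatrix b, ← Polynomial.coe_evalRingHom,
      RingHom.map_det]
    congr 1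
    have : ((1 + s • A : V →L[ℝ] V) : V →ₗ[ℝ] V) = 1 + s • (A : V →ₗ[ℝ] V) := rfl
    rw [this, (LinearMap.toMatrix b b).map_add, (LinearMap.toMatrix b b).map_smul,
      LinearMap.toMatrix_one]
    ext i j
    by_cases h : i = j <;> simp [h, M] <;> ring

lemma det_one_add_smul_pos (A : V →L[ℝ] V) {t : ℝ} (ht : 0 ≤ t) (h : t * ‖A‖ < 1) :
    0 < (1 + t • A).det := by
  obtain ⟨P, -, hP⟩ := exists_polynomial_det_one_add_smul A
  rw [← hP]
  by_contra! hneg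
  have h0 : P.eval 0 = 1 := by
    rw [hP, zero_smul, add_zero]; exact LinearMap.det_id
  obtain ⟨s, hs, hs0⟩ := intermediate_value_Icc' ht P.continuous.continuousOn
    (show (0 : ℝ) ∈ Set.Icc (P.eval t) (P.eval 0) from ⟨hneg, by rw [h0]; exact zero_le_one⟩)
  replace hs0 : (1 + s • A).det = 0 := by rw [← hP]; exact hs0
  have hker := LinearMap.bot_lt_ker_of_det_eq_zero hs0
  obtain ⟨v, hv, hv0⟩ := Submodule.exists_mem_ne_zero_of_ne_bot hker.ne'
  have hv' : v + s • A v = 0 := hv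
  have hlt : ‖s • A v‖ < ‖v‖ := by
    rw [norm_smul, Real.norm_of_nonneg hs.1]
    calc s * ‖A v‖ ≤ t * (‖A‖ * ‖v‖) := by
          gcongr
          · exact hs.2
          · exact A.le_opNorm v
      _ = (t * ‖A‖) * ‖v‖ := by ring
      _ < 1 * ‖v‖ := by
          have := norm_pos_iff.2 hv0
          gcongr
      _ = ‖v‖ := one_mul _
  exact hlt.ne' (by rw [← norm_neg (s • A v), ← eq_neg_of_add_eq_zero_left hv'])

/-- `s ↦ det (1 + s A)` is a polynomial of degree at most `dim V`, so its value at `1` is a fixed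
linear combination of its values at `dim V + 1` nodes. -/
lemma det_one_add_eq_sum (A : V →L[ℝ] V) {t : ℕ → ℝ} (ht : Function.Injective t) :
    (1 + A).det = ∑ i ∈ Finset.range (finrank ℝ V + 1),
      (Lagrange.basis (Finset.range (finrank ℝ V + 1)) t i).eval 1 * (1 + t i • A).det := by
  obtain ⟨P, hd, hP⟩ := exists_polynomial_det_one_add_smul A
  have hlt : P.degree < (Finset.range (finrank ℝ V + 1)).card := by
    rw [Finset.card_range]
    exact (Polynomial.degree_le_of_natDegree_le hd).trans_lt (by exact_mod_cast Nat.lt_succ_self _)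
  have h := congrArg (Polynomial.eval 1) (Lagrange.eq_interpolate ht.injOn hlt)
  rw [hP, one_smul, Lagrange.interpolate_apply, Polynomial.eval_finsetSum] at h
  rw [h]
  refine Finset.sum_congr rfl fun i _ => ?_
  rw [Polynomial.eval_mul, Polynomial.eval_C, hP, mul_comm]

end Determinant

/-! ### Volume and Lipschitz perturbations of the identity -/

section ChangeOfVariables

variable {V : Type*} [NormedAddCommGroup V] [NormedSpace ℝ V]

lemma norm_smul_sub_smul_le {g : V → V} {K : ℝ≥0} (hg : LipschitzWith K g) {t : ℝ}
    (ht : 0 ≤ t) (x y : V) :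
    ‖t • g x - t • g y‖ ≤ t * K * ‖x - y‖ := by
  rw [← smul_sub, norm_smul, Real.norm_of_nonneg ht, mul_assoc]
  gcongr
  simpa [dist_eq_norm] using hg.dist_le_mul x y

lemma injective_add_smul {g : V → V} {K : ℝ≥0} (hg : LipschitzWith K g) {t : ℝ}
    (ht : 0 ≤ t) (htK : t * K < 1) : Function.Injective fun x => x + t • g x := by
  intro x y hxy
  have h1 := norm_smul_sub_smul_le hg ht x y
  have h2 : x - y = -(t • g x - t • g y) := by
    have : x + t • g x = y + t • g y := hxy
    rw [neg_sub, sub_eq_sub_iff_add_eq_add, add_comm _ y, this]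
  rw [← norm_neg (t • g x - t • g y), ← h2] at h1
  have h3 : ‖x - y‖ ≤ 0 := by nlinarith [norm_nonneg (x - y)]
  exact sub_eq_zero.1 (norm_le_zero_iff.1 h3)

lemma surjective_add_smul [CompleteSpace V] {g : V → V} {K : ℝ≥0} (hg : LipschitzWith K g) {t : ℝ}
    (ht : 0 ≤ t) (htK : t * K < 1) : Function.Surjective fun x => x + t • g x := by
  intro y
  have hc : ContractingWith (t.toNNReal * K) fun x => y - t • g x := by
    refine ⟨?_, LipschitzWith.of_dist_le_mul fun a b => ?_⟩
    · rw [← NNReal.coe_lt_coe]; simpa [ht] using htK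
    · rw [dist_sub_left, dist_eq_norm, dist_eq_norm]
      simpa [ht] using norm_smul_sub_smul_le hg ht a b
  refine ⟨hc.fixedPoint _, ?_⟩
  have := hc.fixedPoint_isFixedPt (f := fun x => y - t • g x)
  change hc.fixedPoint _ + t • g (hc.fixedPoint _) = y
  exact (eq_sub_iff_add_eq.1 this.symm)

lemma image_ball_add_smul [CompleteSpace V] {g : V → V} {K : ℝ≥0} (hg : LipschitzWith K g) {R : ℝ}
    (hgR : ∀ x, R ≤ ‖x‖ → g x = 0) {t : ℝ} (ht : 0 ≤ t) (htK : t * K < 1) :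
    (fun x => x + t • g x) '' ball 0 R = ball 0 R := by
  have hfix : ∀ x, R ≤ ‖x‖ → x + t • g x = x := fun x hx => by rw [hgR x hx, smul_zero, add_zero]
  have hinj := injective_add_smul hg ht htK
  ext y
  simp only [Set.mem_image, mem_ball_zero_iff]
  constructor
  · rintro ⟨x, hx, rfl⟩
    by_contra! hy
    have : x + t • g x = x := hinj (hfix _ hy)
    rw [this] at hy
    exact hy.not_gt hx
  · intro hy
    obtain ⟨x, hx⟩ := surjective_add_smul hg ht htK y
    refine ⟨x, ?_, hx⟩
    by_contra! h
    have : x = y := (hfix x h).symm.trans hx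
    exact h.not_gt (this ▸ hy)

variable [MeasurableSpace V] [BorelSpace V]

lemma image_null_of_lipschitzWith {f : V → V} {K : ℝ≥0} (hf : LipschitzWith K f) {s : Set V}
    (hs : μH[finrank ℝ V] s = 0) : μH[finrank ℝ V] (f '' s) = 0 := by
  have := hf.hausdorffMeasure_image_le (d := finrank ℝ V) (Nat.cast_nonneg _) s
  rw [hs, mul_zero] at this
  exact le_antisymm this zero_le

variable [FiniteDimensional ℝ V]

/-- For small `t ≥ 0` the map `x ↦ x + t g(x)` permutes the ball outside which `g` vanishes, so the
integral of its Jacobian determinant is the volume of the ball. -/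
lemma integral_det_one_add_smul_fderiv {g : V → V} {K : ℝ≥0} (hg : LipschitzWith K g) {R : ℝ}
    (hgR : ∀ x, R ≤ ‖x‖ → g x = 0) {t : ℝ} (ht : 0 ≤ t) (htK : t * K < 1) :
    IntegrableOn (fun x => (1 + t • fderiv ℝ g x).det)
      (ball 0 R ∩ {x | DifferentiableAt ℝ g x}) μH[finrank ℝ V] ∧
    ∫ x in ball 0 R ∩ {x | DifferentiableAt ℝ g x}, (1 + t • fderiv ℝ g x).det ∂μH[finrank ℝ V]
      = (μH[finrank ℝ V] : Measure V).real (ball 0 R) := by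
  set μ : Measure V := μH[finrank ℝ V]
  set s : Set V := ball 0 R ∩ {x | DifferentiableAt ℝ g x}
  set F : V → V := fun x => x + t • g x
  have hs : MeasurableSet s :=
    isOpen_ball.measurableSet.inter (measurableSet_of_differentiableAt ℝ g)
  have hF' : ∀ x ∈ s, HasFDerivWithinAt F (1 + t • fderiv ℝ g x) s x := fun x hx =>
    ((hasFDerivAt_id x).add (hx.2.hasFDerivAt.const_smul t)).hasFDerivWithinAt
  have hinj : Set.InjOn F s := (injective_add_smul hg ht htK).injOn
  have hpos : ∀ x, 0 < (1 + t • fderiv ℝ g x).det := fun x =>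
    det_one_add_smul_pos _ ht ((mul_le_mul_of_nonneg_left
      (norm_fderiv_le_of_lipschitz ℝ hg) ht).trans_lt htK)
  have hFlip : LipschitzWith (1 + ‖t‖₊ * K) F :=
    LipschitzWith.id.add ((lipschitzWith_smul t).comp hg)
  have hnull : μ (ball 0 R \ s) = 0 := by
    refine measure_mono_null ?_ (ae_iff.1 (hg.ae_differentiableAt (μ := μ)))
    intro x hx hd
    exact hx.2 ⟨hx.1, hd⟩
  -- Lipschitz maps preserve null sets, so the points of non-differentiability do not matter
  have himage : F '' s =ᵐ[μ] ball (0 : V) R := by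
    have hsub : F '' s ⊆ ball 0 R := by
      rw [← image_ball_add_smul hg hgR ht htK]
      exact Set.image_mono Set.inter_subset_left
    refine (Filter.eventuallyLE_antisymm_iff.2 ⟨hsub.eventuallyLE, ?_⟩)
    refine ae_le_set.2 (measure_mono_null ?_ (image_null_of_lipschitzWith hFlip hnull))
    rintro y ⟨hy, hys⟩
    rw [← image_ball_add_smul hg hgR ht htK] at hy
    obtain ⟨x, hx, rfl⟩ := hy
    exact ⟨x, ⟨hx, fun h => hys ⟨x, h, rfl⟩⟩, rfl⟩
  have h1 := integrableOn_image_iff_integrableOn_abs_det_fderiv_smul μ hs hF' hinj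
    (fun _ => (1 : ℝ))
  have h2 := integral_image_eq_integral_abs_det_fderiv_smul μ hs hF' hinj (fun _ => (1 : ℝ))
  simp only [abs_of_pos (hpos _), smul_eq_mul, mul_one] at h1 h2
  refine ⟨h1.1 ?_, ?_⟩
  · rw [integrableOn_congr_set_ae himage]
    exact integrableOn_const measure_ball_lt_top.ne
  · rw [← h2, setIntegral_congr_set himage]
    simp

end ChangeOfVariables

/-! ### Brouwer's fixed point theorem -/

section Brouwer

variable {V : Type*} [NormedAddCommGroup V] [InnerProductSpace ℝ V] [FiniteDimensional ℝ V]

/-- If `‖F‖ = R > 0` near `x`, then the range of `DF(x)` is orthogonal to `F x`, so `DF(x)` is not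
surjective. -/
lemma det_fderiv_eq_zero_of_norm_eq {F : V → V} {A : V →L[ℝ] V} {x : V} (hA : HasFDerivAt F A x)
    {R : ℝ} (hR : 0 < R) (hF : ∀ᶠ y in nhds x, ‖F y‖ = R) : A.det = 0 := by
  by_contra hdet
  have hconst : HasFDerivAt (fun y => ‖F y‖ ^ 2) (0 : V →L[ℝ] ℝ) x :=
    (hasFDerivAt_const (R ^ 2) x).congr_of_eventuallyEq (hF.mono fun y hy => by simp only [hy])
  have horth : ∀ v, inner ℝ (F x) (A v) = 0 := fun v => by
    have := DFunLike.congr_fun (hA.norm_sq.unique hconst) v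
    simpa using this
  have hsurj : Function.Surjective A := by
    have hu : IsUnit (A : V →ₗ[ℝ] V) :=
      (LinearMap.isUnit_iff_isUnit_det _).2 (isUnit_iff_ne_zero.2 hdet)
    exact ((Module.End.isUnit_iff _).1 hu).2
  obtain ⟨v, hv⟩ := hsurj (F x)
  have h0 := horth v
  rw [hv, real_inner_self_eq_norm_sq, hF.self_of_nhds] at h0
  exact (pow_pos hR 2).ne' h0

/-- There is no Lipschitz retraction of a ball onto its boundary sphere, stated for a displacement
`g` that vanishes outside the ball: otherwise `det (1 + Dg)` would vanish almost everywhere on the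
ball, whereas interpolation in `t` from small `t` gives it the volume of the ball as integral. -/
lemma not_forall_norm_add_eq {g : V → V} {K : ℝ≥0} (hg : LipschitzWith K g) {R : ℝ} (hR : 0 < R)
    (hgR : ∀ x, R ≤ ‖x‖ → g x = 0) : ¬ ∀ x, ‖x‖ < R → ‖x + g x‖ = R := by
  intro hF
  let _ : MeasurableSpace V := borel V
  have : BorelSpace V := ⟨rfl⟩
  set μ : Measure V := μH[finrank ℝ V]
  set s : Set V := ball 0 R ∩ {x | DifferentiableAt ℝ g x}
  have hs : MeasurableSet s :=
    isOpen_ball.measurableSet.inter (measurableSet_of_differentiableAt ℝ g)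
  -- distinct nodes in `(0, 1 / (K + 1)]`, at which the change of variables is available
  let t : ℕ → ℝ := fun i => 1 / ((K + 1) * (i + 1))
  have hK : (0 : ℝ) < K + 1 := by positivity
  have ht0 : ∀ i, 0 ≤ t i := fun i => by positivity
  have htK : ∀ i, t i * K < 1 := fun i => by
    have : (0 : ℝ) < (K + 1) * (i + 1) := by positivity
    simp only [t]
    rw [div_mul_eq_mul_div, one_mul, div_lt_one this]
    nlinarith [K.coe_nonneg, (Nat.cast_nonneg i : (0 : ℝ) ≤ i)]
  have htinj : Function.Injective t := fun i j h => by
    have h2 : ((K : ℝ) + 1) * (i + 1) = (K + 1) * (j + 1) :=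
      inv_injective (by rw [← one_div, ← one_div]; exact h)
    exact_mod_cast add_right_cancel (mul_left_cancel₀ hK.ne' h2)
  have hI := fun i => integral_det_one_add_smul_fderiv hg hgR (ht0 i) (htK i)
  have hdet : ∀ x ∈ s, (1 + fderiv ℝ g x).det = 0 := fun x hx => by
    refine det_fderiv_eq_zero_of_norm_eq ((hasFDerivAt_id x).add hx.2.hasFDerivAt) hR ?_
    filter_upwards [isOpen_ball.mem_nhds hx.1] with y hy
    exact hF y (mem_ball_zero_iff.1 hy)
  set I := Finset.range (finrank ℝ V + 1)
  have h0 : ∫ x in s, (1 + fderiv ℝ g x).det ∂μ = 0 := setIntegral_eq_zero_of_forall_eq_zero hdet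
  have hsum : ∑ i ∈ I, (Lagrange.basis I t i).eval 1 = 1 := by
    rw [← Polynomial.eval_finsetSum, Lagrange.sum_basis htinj.injOn ⟨0, by simp [I]⟩,
      Polynomial.eval_one]
  rw [integral_congr_ae (ae_of_all _ fun x => det_one_add_eq_sum (fderiv ℝ g x) htinj),
    integral_finsetSum _ fun i _ => (hI i).1.const_mul _] at h0
  simp_rw [integral_const_mul, (hI _).2] at h0
  rw [← Finset.sum_mul, hsum, one_mul] at h0
  exact (measure_ball_pos μ (0 : V) hR).ne' ((measureReal_eq_zero_iff measure_ball_lt_top.ne).1 h0)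

/-- A Lipschitz map that is the identity outside a ball has a zero in the ball: otherwise its
normalisation would be a retraction onto the sphere. -/
lemma exists_eq_zero_of_eq_self_outside {h : V → V} {K : ℝ≥0} (hh : LipschitzWith K h) {R : ℝ}
    (hR : 0 < R) (hout : ∀ x, R ≤ ‖x‖ → h x = x) : ∃ x, h x = 0 := by
  by_contra! hne
  obtain ⟨x₀, -, hx₀⟩ := (isCompact_closedBall (0 : V) R).exists_isMinOn
    (nonempty_closedBall.2 hR.le) hh.continuous.norm.continuousOn
  -- a positive lower bound for `‖h‖` on the ball
  set c := min R ‖h x₀‖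
  have hc : 0 < c := lt_min hR (norm_pos_iff.2 (hne x₀))
  have hcR : c ≤ R := min_le_left _ _
  have hch : ∀ x, ‖x‖ ≤ R → c ≤ ‖h x‖ := fun x hx =>
    (min_le_right _ _).trans (hx₀ (mem_closedBall_zero_iff.2 hx))
  -- on the ball `x + g x` is `h x` scaled to norm `R`; off the ball both terms are `R x / ‖x‖`
  let g : V → V := fun x => (R / c) • radialRetract c (h x) - radialRetract R x
  have hg : LipschitzWith (‖R / c‖₊ * (2 * K) + 2) g :=
    ((lipschitzWith_smul _).comp ((lipschitzWith_radialRetract hc).comp hh)).sub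
      (lipschitzWith_radialRetract hR)
  refine not_forall_norm_add_eq hg hR (fun x hx => ?_) fun x hx => ?_
  · simp only [g, hout x hx, radialRetract, max_eq_right hx, max_eq_right (hcR.trans hx), smul_smul]
    rw [sub_eq_zero]
    congr 1
    field_simp
  · simp only [g]
    rw [radialRetract_of_norm_le hR hx.le, add_sub_cancel, norm_smul,
      norm_radialRetract_of_le_norm hc (hch x hx.le), Real.norm_of_nonneg (by positivity)]
    field_simp

/-- **Brouwer's fixed point theorem** for bounded Lipschitz maps. -/
theorem exists_fixedPoint_of_bounded {f : V → V} {K : ℝ≥0} (hf : LipschitzWith K f) {M : ℝ}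
    (hM : ∀ x, ‖f x‖ ≤ M) : ∃ x, f x = x := by
  have hM0 : 0 ≤ M := (norm_nonneg _).trans (hM 0)
  -- a cutoff, equal to `1` on the ball of radius `M` and to `0` outside that of radius `M + 1`
  let χ : V → ℝ := fun x => max 0 (min 1 (M + 1 - ‖x‖))
  have hχ0 : ∀ x, 0 ≤ χ x := fun x => le_max_left _ _
  have hχ1 : ∀ x, χ x ≤ 1 := fun x => max_le zero_le_one (min_le_left _ _)
  have hχ : ∀ x y, |χ x - χ y| ≤ ‖x - y‖ := fun x y => by
    have h1 := abs_max_sub_max_le_max 0 (min 1 (M + 1 - ‖x‖)) 0 (min 1 (M + 1 - ‖y‖))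
    have h2 := abs_min_sub_min_le_max 1 (M + 1 - ‖x‖) 1 (M + 1 - ‖y‖)
    simp only [sub_self, abs_zero, abs_nonneg, sup_of_le_right] at h1 h2
    refine h1.trans (h2.trans ?_)
    rw [sub_sub_sub_cancel_left, norm_sub_rev]
    exact abs_norm_sub_norm_le y x
  have hχf : LipschitzWith (M.toNNReal + K) fun x => χ x • f x := by
    refine LipschitzWith.of_dist_le_mul fun x y => ?_
    rw [dist_eq_norm, dist_eq_norm]
    have e : χ x • f x - χ y • f y = (χ x - χ y) • f x + χ y • (f x - f y) := by
      rw [sub_smul, smul_sub]; abel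
    rw [e]
    refine (norm_add_le _ _).trans ?_
    rw [norm_smul, norm_smul, Real.norm_eq_abs, Real.norm_of_nonneg (hχ0 y), NNReal.coe_add,
      Real.coe_toNNReal _ hM0]
    have h1 := mul_le_mul (hχ x y) (hM x) (norm_nonneg _) (norm_nonneg _)
    have h2 : ‖f x - f y‖ ≤ K * ‖x - y‖ := by simpa [dist_eq_norm] using hf.dist_le_mul x y
    have h3 := mul_le_of_le_one_left (norm_nonneg (f x - f y)) (hχ1 y)
    linarith
  obtain ⟨x, hx⟩ := exists_eq_zero_of_eq_self_outside (R := M + 1)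
    (LipschitzWith.id.sub hχf) (by positivity) fun x hx => by
      have : χ x = 0 := max_eq_left (min_le_of_right_le (by linarith))
      simp [this]
  have hx' : x = χ x • f x := sub_eq_zero.1 hx
  have hxM : ‖x‖ ≤ M := by
    rw [hx', norm_smul, Real.norm_of_nonneg (hχ0 x)]
    exact (mul_le_of_le_one_left (norm_nonneg _) (hχ1 x)).trans (hM x)
  have hχx : χ x = 1 := by
    simp only [χ]
    rw [min_eq_left (by linarith), max_eq_right zero_le_one]
  rw [hχx, one_smul] at hx'
  exact ⟨x, hx'.symm⟩

end Brouwer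

/-! ### Schauder's fixed point theorem -/

section Schauder

/-- A Lipschitz self-map of a Hilbert space with totally bounded range has approximate fixed points:
project it orthogonally to the span of a finite net of its range. -/
lemma exists_norm_sub_le_of_totallyBounded {H : Type*} [NormedAddCommGroup H]
    [InnerProductSpace ℝ H] {f : H → H} {K : ℝ≥0} (hf : LipschitzWith K f)
    (hr : TotallyBounded (Set.range f)) {ε : ℝ} (hε : 0 < ε) : ∃ x, ‖f x - x‖ ≤ ε := by
  obtain ⟨t, -, htf, ht⟩ := finite_approx_of_totallyBounded hr ε hε
  obtain ⟨M, hM⟩ := isBounded_iff_forall_norm_le.1 hr.isBounded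
  let V := Submodule.span ℝ t
  have : FiniteDimensional ℝ V := FiniteDimensional.span_of_finite ℝ htf
  have hlip : LipschitzWith (‖V.orthogonalProjectionOnto‖₊ * (K * 1))
      fun v : V => V.orthogonalProjectionOnto (f v) :=
    V.orthogonalProjectionOnto.lipschitz.comp (hf.comp (LipschitzWith.subtype_val _))
  obtain ⟨v, hv⟩ := exists_fixedPoint_of_bounded hlip (M := M) fun v =>
    (V.norm_orthogonalProjectionOnto_apply_le _).trans (hM _ ⟨v, rfl⟩)
  refine ⟨v, ?_⟩
  obtain ⟨y, hy, hfy⟩ := Set.mem_iUnion₂.1 (ht ⟨(v : H), rfl⟩)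
  have hv' : V.starProjection (f v) = v := congrArg Subtype.val hv
  have hmin : ‖f v - v‖ ≤ ‖f v - y‖ := by
    have := (V.starProjection_minimal (f v)).trans_le
      (ciInf_le ⟨0, by rintro _ ⟨w, rfl⟩; exact norm_nonneg _⟩ (⟨y, Submodule.subset_span hy⟩ : V))
    rwa [hv'] at this
  exact hmin.trans (mem_ball_iff_norm.1 hfy).le

/-- **Schauder's fixed point theorem** for Lipschitz self-maps, with totally bounded range, of a
Hilbert space. -/
theorem exists_fixedPoint_of_totallyBounded {H : Type*} [NormedAddCommGroup H]
    [InnerProductSpace ℝ H] [CompleteSpace H] {f : H → H} {K : ℝ≥0} (hf : LipschitzWith K f)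
    (hr : TotallyBounded (Set.range f)) : ∃ x, f x = x := by
  have hC : IsCompact (closure (Set.range f)) :=
    hr.closure.isCompact_of_isClosed isClosed_closure
  choose x hx using fun k : ℕ =>
    exists_norm_sub_le_of_totallyBounded hf hr (ε := 1 / ((k : ℝ) + 1)) (by positivity)
  obtain ⟨y, -, σ, hσ, hy⟩ := hC.tendsto_subseq fun k => subset_closure ⟨x k, rfl⟩
  have hdiff : Filter.Tendsto (fun k => f (x (σ k)) - x (σ k)) Filter.atTop (nhds 0) :=
    (squeeze_zero_norm hx tendsto_one_div_add_atTop_nhds_zero_nat).comp hσ.tendsto_atTop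
  have hxy : Filter.Tendsto (fun k => x (σ k)) Filter.atTop (nhds y) := by
    simpa using hy.sub hdiff
  exact ⟨y, tendsto_nhds_unique ((hf.continuous.tendsto y).comp hxy) hy⟩

end Schauder

/-! ### Coercive forms on Banach spaces -/

section Renorming

universe u

variable {E : Type*} [NormedAddCommGroup E] [NormedSpace ℝ E]

/-- A copy of `E` without its norm, to carry the energy norm of a coercive form. -/
def EnergySpace (E : Type*) : Type _ := E

noncomputable instance : AddCommGroup (EnergySpace E) := inferInstanceAs (AddCommGroup E)

noncomputable instance : Module ℝ (EnergySpace E) := inferInstanceAs (Module ℝ E)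

/-- The identity map from the copy `EnergySpace E` to `E`. -/
def ofEnergy (E : Type*) [NormedAddCommGroup E] [NormedSpace ℝ E] : EnergySpace E ≃ₗ[ℝ] E :=
  LinearEquiv.refl ℝ E

/-- The inner product `⟪f, g⟫ = (⟨A f, g⟩ + ⟨A g, f⟩) / 2` of a coercive operator `A`. -/
noncomputable abbrev energyCore (A : E →ₗ[ℝ] StrongDual ℝ E) {a : ℝ} (ha : 0 < a)
    (hA : ∀ f, a * ‖f‖ ^ 2 ≤ A f f) : InnerProductSpace.Core ℝ (EnergySpace E) where
  inner f g := (A (ofEnergy E f) (ofEnergy E g) + A (ofEnergy E g) (ofEnergy E f)) / 2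
  conj_inner_symm f g := by simp [add_comm]
  re_inner_nonneg f := by
    rw [add_self_div_two]
    exact le_trans (by positivity) (hA (ofEnergy E f))
  add_left f g h := by
    simp only [map_add, add_apply]
    ring
  smul_left f g c := by
    simp only [map_smul, smul_apply, smul_eq_mul, conj_trivial]
    ring
  definite f hf := by
    rw [add_self_div_two] at hf
    have h := hA (ofEnergy E f)
    rw [hf] at h
    have h2 : ‖ofEnergy E f‖ ^ 2 = 0 :=
      le_antisymm (nonpos_of_mul_nonpos_right h ha) (by positivity)
    exact (ofEnergy E).map_eq_zero_iff.1 (norm_eq_zero.1 (pow_eq_zero_iff two_ne_zero |>.1 h2))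

/-- A Banach space that carries a bounded coercive bilinear form is isomorphic to a Hilbert space:
the symmetric part of the form is an inner product whose norm is equivalent to the given one. -/
lemma exists_hilbert_equiv {E : Type u} [NormedAddCommGroup E] [NormedSpace ℝ E] [CompleteSpace E]
    (A : E →ₗ[ℝ] StrongDual ℝ E) {a C : ℝ} (ha : 0 < a)
    (hA : ∀ f, a * ‖f‖ ^ 2 ≤ A f f) (hC : ∀ f, ‖A f‖ ≤ C * ‖f‖) :
    ∃ (H : Type u) (_ : NormedAddCommGroup H) (_ : InnerProductSpace ℝ H) (_ : CompleteSpace H),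
      Nonempty (H ≃L[ℝ] E) := by
  let core := energyCore A ha hA
  let _ : NormedAddCommGroup (EnergySpace E) := core.toNormedAddCommGroup
  let _ : InnerProductSpace ℝ (EnergySpace E) := InnerProductSpace.ofCore core.toCore
  let e : EnergySpace E ≃ₗ[ℝ] E := ofEnergy E
  have hsq : ∀ f : EnergySpace E, ‖f‖ ^ 2 = A (e f) (e f) := fun f => by
    rw [← real_inner_self_eq_norm_sq]
    exact add_self_div_two _
  have hto : ∀ f : EnergySpace E, ‖e f‖ ≤ (√a)⁻¹ * ‖f‖ := fun f => by
    rw [← div_eq_inv_mul, le_div_iff₀ (Real.sqrt_pos.2 ha)]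
    refine le_of_sq_le_sq ?_ (norm_nonneg _)
    rw [mul_pow, Real.sq_sqrt ha.le, hsq, mul_comm]
    exact hA _
  have hinv : ∀ f : E, ‖e.symm f‖ ≤ √|C| * ‖f‖ := fun f => by
    refine le_of_sq_le_sq ?_ (by positivity)
    rw [hsq, mul_pow, Real.sq_sqrt (abs_nonneg C), LinearEquiv.apply_symm_apply]
    calc A f f ≤ ‖A f‖ * ‖f‖ := (le_abs_self _).trans ((A f).le_opNorm f)
      _ ≤ (|C| * ‖f‖) * ‖f‖ := by
          gcongr
          exact (hC f).trans (by gcongr; exact le_abs_self C)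
      _ = _ := by ring
  let e' := e.toContinuousLinearEquivOfBounds _ _ hto hinv
  exact ⟨EnergySpace E, _, _,
    (completeSpace_congr (e := e'.toEquiv) e'.isUniformEmbedding).2 inferInstance, ⟨e'⟩⟩

/-- The **Lax-Milgram theorem** on a Banach space. -/
lemma exists_eq_of_coercive [CompleteSpace E] (A : E →ₗ[ℝ] StrongDual ℝ E) {a C : ℝ} (ha : 0 < a)
    (hA : ∀ f, a * ‖f‖ ^ 2 ≤ A f f) (hC : ∀ f, ‖A f‖ ≤ C * ‖f‖) (F : StrongDual ℝ E) :
    ∃ w, A w = F := by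
  obtain ⟨H, _, _, _, ⟨e⟩⟩ := exists_hilbert_equiv A ha hA hC
  let b : H →L[ℝ] H →L[ℝ] ℝ :=
    (A.mkContinuous C hC).bilinearComp (e : H →L[ℝ] E) (e : H →L[ℝ] E)
  have hb : IsCoercive b := by
    rcases subsingleton_or_nontrivial (H) with h | h
    · refine ⟨1, one_pos, fun u => ?_⟩
      rw [Subsingleton.elim u 0]
      simp
    · have hpos : 0 < ‖(e.symm : E →L[ℝ] H)‖ := e.norm_symm_pos
      refine ⟨a / ‖(e.symm : E →L[ℝ] H)‖ ^ 2, by positivity, fun u => ?_⟩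
      have h1 : ‖u‖ ≤ ‖(e.symm : E →L[ℝ] H)‖ * ‖e u‖ := by
        simpa using (e.symm : E →L[ℝ] H).le_opNorm (e u)
      refine le_trans ?_ (hA (e u))
      rw [mul_assoc, ← sq, div_mul_eq_mul_div, div_le_iff₀ (by positivity), mul_assoc, ← mul_pow,
        mul_comm ‖e u‖]
      gcongr
  obtain ⟨u, hu⟩ := hb.continuousLinearEquivOfBilin.surjective
    ((InnerProductSpace.toDual ℝ (H)).symm (F.comp (e : H →L[ℝ] E)))
  refine ⟨e u, ContinuousLinearMap.ext fun g => ?_⟩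
  have h := hb.continuousLinearEquivOfBilin_apply u (e.symm g)
  rw [hu, InnerProductSpace.toDual_symm_apply] at h
  simpa [b] using h.symm

end Renorming

/-! ### Fixed points of compact maps of a ball -/

section FixedPoint

lemma totallyBounded_image_of_dist_le {X Y Z : Type*} [PseudoMetricSpace Y] [PseudoMetricSpace Z]
    {p : X → Y} {f : X → Z} {s : Set X} {C : ℝ} (hs : TotallyBounded (p '' s))
    (hf : ∀ x ∈ s, ∀ y ∈ s, dist (f x) (f y) ≤ C * dist (p x) (p y)) :
    TotallyBounded (f '' s) := by
  refine Metric.totallyBounded_iff.2 fun ε hε => ?_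
  have hC : 0 < |C| + 1 := by positivity
  obtain ⟨t, hts, htf, ht⟩ := Set.exists_subset_image_finite_and.1
    (finite_approx_of_totallyBounded hs (ε / (|C| + 1)) (by positivity))
  refine ⟨f '' t, htf.image f, ?_⟩
  rintro _ ⟨x, hx, rfl⟩
  obtain ⟨_, ⟨y, hy, rfl⟩, hxy⟩ := Set.mem_iUnion₂.1 (ht ⟨x, hx, rfl⟩)
  refine Set.mem_iUnion₂.2 ⟨f y, ⟨y, hy, rfl⟩, ?_⟩
  rw [mem_ball] at hxy ⊢
  calc dist (f x) (f y) ≤ C * dist (p x) (p y) := hf x hx y (hts hy)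
    _ ≤ (|C| + 1) * dist (p x) (p y) := by
        gcongr
        exact (le_abs_self C).trans (by linarith)
    _ < ε := by rwa [lt_div_iff₀' hC] at hxy

variable {E B H : Type*} [NormedAddCommGroup E] [NormedSpace ℝ E]
  [NormedAddCommGroup B] [NormedSpace ℝ B]
  [NormedAddCommGroup H] [InnerProductSpace ℝ H] [CompleteSpace H]

/-- A self-map of a ball that is Lipschitz from a compactly weaker norm to the norm of `E` has a
fixed point, if `E` is isomorphic to a Hilbert space. -/
lemma exists_fixedPoint_of_compact (e : H ≃L[ℝ] E) {ι : E →L[ℝ] B} (hι : IsCompactOperator ι)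
    {T : E → E} {R C : ℝ} (hR : 0 ≤ R) (hT : ∀ u, ‖u‖ ≤ R → ‖T u‖ ≤ R)
    (hlip : ∀ u v, ‖u‖ ≤ R → ‖v‖ ≤ R → ‖T u - T v‖ ≤ C * ‖ι u - ι v‖) :
    ∃ u, ‖u‖ ≤ R ∧ T u = u := by
  rcases hR.eq_or_lt with rfl | hR
  · refine ⟨0, by simp, norm_le_zero_iff.1 (hT 0 (by simp))⟩
  -- extend `T` from the ball to `E`; the range stays the same
  let f : E → E := fun u => T (radialRetract R u)
  have hf : LipschitzWith (|C|.toNNReal * ‖ι‖₊ * 2) f := by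
    refine LipschitzWith.of_dist_le_mul fun u v => ?_
    rw [dist_eq_norm, dist_eq_norm]
    simp only [NNReal.coe_mul, Real.coe_toNNReal _ (abs_nonneg C), coe_nnnorm, NNReal.coe_ofNat]
    have hr : ‖radialRetract R u - radialRetract R v‖ ≤ 2 * ‖u - v‖ := by
      simpa [dist_eq_norm] using (lipschitzWith_radialRetract hR).dist_le_mul u v
    calc ‖f u - f v‖ ≤ C * ‖ι (radialRetract R u) - ι (radialRetract R v)‖ :=
          hlip _ _ (norm_radialRetract_le hR u) (norm_radialRetract_le hR v)
      _ ≤ |C| * (‖ι‖ * (2 * ‖u - v‖)) := by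
          rw [← map_sub]
          gcongr
          · exact le_abs_self C
          · exact (ι.le_opNorm _).trans (by gcongr)
      _ = _ := by ring
  have htb : TotallyBounded (Set.range f) := by
    have hball : TotallyBounded (T '' closedBall 0 R) :=
      totallyBounded_image_of_dist_le (C := C)
        ((hι.isCompact_closure_image_closedBall R).totallyBounded.subset subset_closure)
        fun x hx y hy => by
          simpa [dist_eq_norm] using
            hlip x y (mem_closedBall_zero_iff.1 hx) (mem_closedBall_zero_iff.1 hy)
    refine hball.subset ?_
    rintro _ ⟨u, rfl⟩
    exact ⟨_, mem_closedBall_zero_iff.2 (norm_radialRetract_le hR u), rfl⟩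
  obtain ⟨x, hx⟩ := exists_fixedPoint_of_totallyBounded (f := fun x => e.symm (f (e x)))
    (e.symm.lipschitz.comp (hf.comp e.lipschitz)) <| by
      refine (htb.image e.symm.lipschitz.uniformContinuous).subset ?_
      rintro _ ⟨x, rfl⟩
      exact ⟨_, ⟨e x, rfl⟩, rfl⟩
  have hfix : f (e x) = e x := by
    rw [← e.apply_symm_apply (f (e x)), hx]
  have hle : ‖e x‖ ≤ R := by
    rw [← hfix]; exact hT _ (norm_radialRetract_le hR _)
  refine ⟨e x, hle, ?_⟩
  simpa only [f, radialRetract_of_norm_le hR hle] using hfix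

end FixedPoint

/-! ### Estimates for the operators -/

section Estimates

variable {H0 H1 B : Type*}
  [NormedAddCommGroup H0] [InnerProductSpace ℝ H0]
  [NormedAddCommGroup H1] [NormedSpace ℝ H1]
  [NormedAddCommGroup B] [NormedSpace ℝ B]
  {ι : H1 →L[ℝ] B} {κ : B →L[ℝ] H0} {L₁ : H1 →ₗ[ℝ] StrongDual ℝ H1} {L₂ : H0 →ₗ[ℝ] H0}
  {n : ℕ} {S : H1 →ₗ[ℝ] EuclideanSpace ℝ (Fin n)} {ψ r : Fin n → H0} {φ : Fin n → H1}
  {K₀ K₁ K₂ δ₁ ε₁ γ₁ γ₂ : ℝ}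

lemma norm_sum_smul_le {X : Type*} [NormedAddCommGroup X] [NormedSpace ℝ X]
    (c : EuclideanSpace ℝ (Fin n)) (x : Fin n → X) :
    ‖∑ j, c j • x j‖ ≤ ‖c‖ * √(∑ j, ‖x j‖ ^ 2) := by
  refine (norm_sum_le _ _).trans ?_
  simp_rw [norm_smul]
  rw [EuclideanSpace.norm_eq]
  exact Real.sum_mul_le_sqrt_mul_sqrt _ _ _

lemma toDual_apply (h : H0) (g : H1) : toDual ι κ h g = inner ℝ h (κ (ι g)) := rfl

/-- `L₁ + L_res` as a linear map from `H1` to its dual. -/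
noncomputable def mainOp (ι : H1 →L[ℝ] B) (κ : B →L[ℝ] H0)
    (L₁ : H1 →ₗ[ℝ] StrongDual ℝ H1) (L₂ : H0 →ₗ[ℝ] H0)
    (S : H1 →ₗ[ℝ] EuclideanSpace ℝ (Fin n)) (ψ r : Fin n → H0) : H1 →ₗ[ℝ] StrongDual ℝ H1 where
  toFun f := L₁ f + toDual ι κ (residualOp ι κ L₂ S ψ r f)
  map_add' f g := by
    have : residualOp ι κ L₂ S ψ r (f + g)
        = residualOp ι κ L₂ S ψ r f + residualOp ι κ L₂ S ψ r g := by
      simp only [residualOp, finiteRankOp, map_add, PiLp.add_apply, add_smul,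
        Finset.sum_add_distrib]
      abel
    ext x
    simp only [this, map_add, add_apply, toDual_apply, inner_add_left]
    ring
  map_smul' c f := by
    have : residualOp ι κ L₂ S ψ r (c • f) = c • residualOp ι κ L₂ S ψ r f := by
      simp only [residualOp, finiteRankOp, map_smul, PiLp.smul_apply, smul_eq_mul, mul_smul,
        Finset.smul_sum, smul_sub]
    ext x
    simp only [this, map_smul, add_apply, smul_apply, toDual_apply, inner_smul_left,
      conj_trivial, RingHom.id_apply, smul_eq_mul]
    ring

lemma correction_sub (f g : H1) :
    correction S φ (f - g) = correction S φ f - correction S φ g := by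
  simp only [correction, map_sub, PiLp.sub_apply, sub_smul, Finset.sum_sub_distrib]

lemma norm_toDual_apply_le (hL : AprioriBounds ι κ L₁ L₂ K₀ K₁ K₂) (h : H0) (g : H1) :
    |toDual ι κ h g| ≤ K₀ * ‖h‖ * ‖g‖ :=
  calc |toDual ι κ h g| ≤ ‖h‖ * ‖κ (ι g)‖ := abs_real_inner_le_norm _ _
    _ ≤ ‖h‖ * (K₀ * ‖g‖) := by gcongr; exact hL.embed g
    _ = _ := by ring

lemma norm_residualOp_le (hL : AprioriBounds ι κ L₁ L₂ K₀ K₁ K₂)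
    (hfr : FiniteRankApproximation ι κ L₁ L₂ S ψ φ r δ₁ ε₁ γ₁ γ₂) (f : H1) :
    ‖residualOp ι κ L₂ S ψ r f‖ ≤ (K₂ * δ₁ + γ₁ * ε₁) * ‖f‖ := by
  have e : residualOp ι κ L₂ S ψ r f
      = -L₂ (interp S ψ f - κ (ι f)) + ∑ j, S f j • r j := by
    simp only [residualOp, finiteRankOp, interp, map_sub, map_sum, map_smul, smul_sub,
      Finset.sum_sub_distrib]
    abel
  rw [e]
  refine (norm_add_le _ _).trans ?_
  rw [norm_neg, add_mul]
  refine add_le_add ?_ ?_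
  · calc _ ≤ K₂ * ‖interp S ψ f - κ (ι f)‖ := hL.L₂_bound _
      _ ≤ K₂ * (δ₁ * ‖f‖) := mul_le_mul_of_nonneg_left (hfr.interp_error f) hL.K₂_pos.le
      _ = _ := by ring
  · calc _ ≤ ‖S f‖ * √(∑ j, ‖r j‖ ^ 2) := norm_sum_smul_le _ _
      _ ≤ (γ₁ * ‖f‖) * ε₁ :=
          mul_le_mul (hfr.S_bound_H1 f) hfr.residual (Real.sqrt_nonneg _)
            ((norm_nonneg _).trans (hfr.S_bound_H1 f))
      _ = _ := by ring

lemma coercConst_mul_le_mainOp (hL : AprioriBounds ι κ L₁ L₂ K₀ K₁ K₂)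
    (hfr : FiniteRankApproximation ι κ L₁ L₂ S ψ φ r δ₁ ε₁ γ₁ γ₂) (f : H1) :
    coercConst K₀ K₁ K₂ δ₁ ε₁ γ₁ * ‖f‖ ^ 2 ≤ mainOp ι κ L₁ L₂ S ψ r f f := by
  change _ ≤ L₁ f f + toDual ι κ (residualOp ι κ L₂ S ψ r f) f
  have h1 := hL.coercive f
  have h2 := (abs_le.1 (norm_toDual_apply_le hL (residualOp ι κ L₂ S ψ r f) f)).1
  have h3 : K₀ * ‖residualOp ι κ L₂ S ψ r f‖ * ‖f‖
      ≤ K₀ * ((K₂ * δ₁ + γ₁ * ε₁) * ‖f‖) * ‖f‖ :=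
    mul_le_mul_of_nonneg_right
      (mul_le_mul_of_nonneg_left (norm_residualOp_le hL hfr f) hL.K₀_pos.le) (norm_nonneg f)
  unfold coercConst
  linarith

lemma exists_norm_mainOp_le (hL : AprioriBounds ι κ L₁ L₂ K₀ K₁ K₂)
    (hfr : FiniteRankApproximation ι κ L₁ L₂ S ψ φ r δ₁ ε₁ γ₁ γ₂) :
    ∃ C, ∀ f, ‖mainOp ι κ L₁ L₂ S ψ r f‖ ≤ C * ‖f‖ := by
  obtain ⟨C, hC⟩ := hL.bounded
  have hκ := hL.K₀_pos
  have hres := norm_residualOp_le hL hfr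
  refine ⟨|C| + K₀ * |K₂ * δ₁ + γ₁ * ε₁|, fun f => ?_⟩
  refine ContinuousLinearMap.opNorm_le_bound _ (by positivity) fun g => ?_
  calc ‖mainOp ι κ L₁ L₂ S ψ r f g‖
      ≤ |L₁ f g| + |toDual ι κ (residualOp ι κ L₂ S ψ r f) g| := abs_add_le _ _
    _ ≤ |C| * ‖f‖ * ‖g‖ + K₀ * (|K₂ * δ₁ + γ₁ * ε₁| * ‖f‖) * ‖g‖ := by
        refine add_le_add ((hC f g).trans ?_) ((norm_toDual_apply_le hL _ g).trans ?_)
        · gcongr; exact le_abs_self C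
        · gcongr
          exact (hres f).trans (by gcongr; exact le_abs_self _)
    _ = _ := by ring

lemma γ₂_nonneg (hfr : FiniteRankApproximation ι κ L₁ L₂ S ψ φ r δ₁ ε₁ γ₁ γ₂) : 0 ≤ γ₂ :=
  (Real.sqrt_nonneg _).trans hfr.Φ_bound

lemma norm_correction_le (hfr : FiniteRankApproximation ι κ L₁ L₂ S ψ φ r δ₁ ε₁ γ₁ γ₂) (f : H1) :
    ‖correction S φ f‖ ≤ γ₂ * ‖S f‖ := by
  rw [mul_comm]
  exact (norm_sum_smul_le _ _).trans (mul_le_mul_of_nonneg_left hfr.Φ_bound (norm_nonneg _))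

lemma norm_add_correction_le (hfr : FiniteRankApproximation ι κ L₁ L₂ S ψ φ r δ₁ ε₁ γ₁ γ₂)
    {f : H1} {R : ℝ} (hf : ‖f‖ ≤ R) : ‖f + correction S φ f‖ ≤ (1 + γ₁ * γ₂) * R := by
  have h0 := γ₂_nonneg hfr
  have h1 := hfr.γ₁_nonneg
  calc ‖f + correction S φ f‖ ≤ ‖f‖ + γ₂ * (γ₁ * ‖f‖) :=
        (norm_add_le _ _).trans (by
          gcongr
          exact (norm_correction_le hfr f).trans (by gcongr; exact hfr.S_bound_H1 f))
    _ = (1 + γ₁ * γ₂) * ‖f‖ := by ring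
    _ ≤ _ := by gcongr

/-- In the norm of `B` the map `f ↦ f + G f` is bounded, because `S` is bounded in the norm of
`H0`. -/
lemma exists_norm_add_correction_le (hfr : FiniteRankApproximation ι κ L₁ L₂ S ψ φ r δ₁ ε₁ γ₁ γ₂) :
    ∃ D, 0 ≤ D ∧ ∀ f, ‖ι (f + correction S φ f)‖ ≤ D * ‖ι f‖ := by
  obtain ⟨C, hC⟩ := hfr.S_bound_H0
  have h0 := γ₂_nonneg hfr
  refine ⟨1 + ‖ι‖ * (γ₂ * (|C| * ‖κ‖)), by positivity, fun f => ?_⟩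
  have hS : ‖S f‖ ≤ |C| * (‖κ‖ * ‖ι f‖) :=
    (hC f).trans (mul_le_mul (le_abs_self C) (κ.le_opNorm _) (norm_nonneg _) (abs_nonneg C))
  calc ‖ι (f + correction S φ f)‖ ≤ ‖ι f‖ + ‖ι‖ * (γ₂ * (|C| * (‖κ‖ * ‖ι f‖))) := by
        rw [map_add]
        refine (norm_add_le _ _).trans (add_le_add_right ?_ _)
        refine (ι.le_opNorm _).trans ?_
        gcongr
        exact (norm_correction_le hfr f).trans (by gcongr)
    _ = _ := by ring

/-- The linear combination of the equations `L φᵢ = -L₂ ψᵢ + rᵢ` with coefficients `sᵢ(f)`. -/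
lemma fullOp_correction (hfr : FiniteRankApproximation ι κ L₁ L₂ S ψ φ r δ₁ ε₁ γ₁ γ₂) (f : H1) :
    fullOp ι κ L₁ L₂ (correction S φ f) = -toDual ι κ (finiteRankOp L₂ S ψ r f) := by
  ext g
  have h : ∀ i, L₁ (φ i) g + inner ℝ (L₂ (κ (ι (φ i)))) (κ (ι g))
      = -inner ℝ (L₂ (ψ i) - r i) (κ (ι g)) := fun i => by
    have := DFunLike.congr_fun (hfr.solves i) g
    rw [← inner_neg_left, neg_sub, sub_eq_neg_add]
    exact this
  simp only [fullOp, correction, finiteRankOp, map_sum, map_smul, add_apply,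
    neg_apply, sum_apply, smul_apply, toDual_apply,
    sum_inner, inner_smul_left, conj_trivial, smul_eq_mul, ← Finset.sum_add_distrib, ← mul_add, h,
    mul_neg, Finset.sum_neg_distrib]

lemma fullOp_add (f g : H1) :
    fullOp ι κ L₁ L₂ (f + g) = fullOp ι κ L₁ L₂ f + fullOp ι κ L₁ L₂ g := by
  ext x
  simp only [fullOp, map_add, add_apply, toDual_apply, inner_add_left]
  ring

end Estimates

/-! ### The radius -/

section Radius

variable {K₀ K₁ K₂ K₃ δ₁ ε₁ ε₂ γ₁ γ₂ : ℝ}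

/-- The radius is a root of `K₃ (1 + γ₁ γ₂)² x² - a x + ε₂ K₀`. -/
lemma radius_quadratic (hK₃ : 0 < K₃) (hγ : 0 < 1 + γ₁ * γ₂)
    (hM₄ : 0 ≤ M₄ K₀ K₁ K₂ K₃ δ₁ ε₁ ε₂ γ₁ γ₂) :
    ε₂ * K₀ + K₃ * ((1 + γ₁ * γ₂) * radius K₀ K₁ K₂ K₃ δ₁ ε₁ ε₂ γ₁ γ₂) ^ 2 =
      coercConst K₀ K₁ K₂ δ₁ ε₁ γ₁ * radius K₀ K₁ K₂ K₃ δ₁ ε₁ ε₂ γ₁ γ₂ := by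
  have hsq := Real.sq_sqrt hM₄
  unfold radius
  set s := √(M₄ K₀ K₁ K₂ K₃ δ₁ ε₁ ε₂ γ₁ γ₂)
  unfold M₄ at hsq
  set a := coercConst K₀ K₁ K₂ δ₁ ε₁ γ₁
  field_simp
  linear_combination hsq

lemma radius_nonneg (hK₀ : 0 < K₀) (hK₃ : 0 < K₃) (hε₂ : 0 ≤ ε₂)
    (hpos : 0 < coercConst K₀ K₁ K₂ δ₁ ε₁ γ₁) :
    0 ≤ radius K₀ K₁ K₂ K₃ δ₁ ε₁ ε₂ γ₁ γ₂ := by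
  refine div_nonneg (sub_nonneg.2 (Real.sqrt_le_iff.2 ⟨hpos.le, ?_⟩)) (by positivity)
  exact sub_le_self _ (by positivity)

end Radius

/-! ### Existence of solutions -/

section Existence

/-- The equation for `w₁` alone, `(L₁ + L_res) w₁ = -E - N (w₁ + G w₁)`, has a solution in the ball:
a fixed point of the map `T` that sends `u` to the solution of
`(L₁ + L_res) (T u) = -E - N (u + G u)`. -/
lemma exists_mainOp_eq {H0 H1 B : Type*}
    [NormedAddCommGroup H0] [InnerProductSpace ℝ H0]
    [NormedAddCommGroup H1] [NormedSpace ℝ H1] [CompleteSpace H1]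
    [NormedAddCommGroup B] [NormedSpace ℝ B]
    {ι : H1 →L[ℝ] B} {κ : B →L[ℝ] H0} {L₁ : H1 →ₗ[ℝ] StrongDual ℝ H1} {L₂ : H0 →ₗ[ℝ] H0}
    {N : H1 → StrongDual ℝ H1} {E : H0} {n : ℕ} {S : H1 →ₗ[ℝ] EuclideanSpace ℝ (Fin n)}
    {ψ r : Fin n → H0} {φ : Fin n → H1} {K₀ K₁ K₂ K₃ δ₁ ε₁ ε₂ γ₁ γ₂ : ℝ}
    (hL : AprioriBounds ι κ L₁ L₂ K₀ K₁ K₂)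
    (hfr : FiniteRankApproximation ι κ L₁ L₂ S ψ φ r δ₁ ε₁ γ₁ γ₂)
    (hE : ‖E‖ ≤ ε₂) (hN : NonlinearEstimate ι N K₃)
    (hpos : 0 < coercConst K₀ K₁ K₂ δ₁ ε₁ γ₁)
    (hM₄ : 0 ≤ M₄ K₀ K₁ K₂ K₃ δ₁ ε₁ ε₂ γ₁ γ₂) :
    ∃ w, ‖w‖ ≤ radius K₀ K₁ K₂ K₃ δ₁ ε₁ ε₂ γ₁ γ₂ ∧
      mainOp ι κ L₁ L₂ S ψ r w = -toDual ι κ E - N (w + correction S φ w) := by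
  set R := radius K₀ K₁ K₂ K₃ δ₁ ε₁ ε₂ γ₁ γ₂
  set a := coercConst K₀ K₁ K₂ δ₁ ε₁ γ₁
  have hK₃ := hN.K₃_pos
  have hγ : 0 < 1 + γ₁ * γ₂ := by
    have := mul_nonneg hfr.γ₁_nonneg (γ₂_nonneg hfr)
    linarith
  have hε₂ : 0 ≤ ε₂ := (norm_nonneg E).trans hE
  have hR : 0 ≤ R := radius_nonneg hL.K₀_pos hK₃ hε₂ hpos
  have hcoer := coercConst_mul_le_mainOp hL hfr
  obtain ⟨C, hC⟩ := exists_norm_mainOp_le hL hfr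
  obtain ⟨H, _, _, _, ⟨e⟩⟩ := exists_hilbert_equiv _ hpos hcoer hC
  choose T hT using fun u : H1 => exists_eq_of_coercive (mainOp ι κ L₁ L₂ S ψ r) hpos hcoer hC
    (-toDual ι κ E - N (u + correction S φ u))
  obtain ⟨D, hD0, hD⟩ := exists_norm_add_correction_le hfr
  obtain ⟨Q, hQ⟩ := hN.continuity
  -- a bound `a ‖d‖² ≤ c ‖d‖` gives `a ‖d‖ ≤ c`, also if `d = 0`
  have hdiv : ∀ (d : H1) (c : ℝ), 0 ≤ c → a * ‖d‖ ^ 2 ≤ c * ‖d‖ → a * ‖d‖ ≤ c := by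
    intro d c hc h
    rcases (norm_nonneg d).eq_or_lt with h0 | h0
    · rw [← h0, mul_zero]; exact hc
    · exact le_of_mul_le_mul_right (by linarith) h0
  have hball : ∀ u, ‖u‖ ≤ R → ‖T u‖ ≤ R := fun u hu => by
    have hquad : ε₂ * K₀ + K₃ * ((1 + γ₁ * γ₂) * R) ^ 2 = a * R := radius_quadratic hK₃ hγ hM₄
    refine le_of_mul_le_mul_left ?_ hpos
    rw [← hquad]
    have hK₀ := hL.K₀_pos
    refine hdiv _ _ (by positivity) ((hcoer _).trans ?_)
    rw [hT u]
    have h1 := norm_toDual_apply_le hL E (T u)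
    have h2 := hN.quadratic (u + correction S φ u) (T u)
    have h3 : K₀ * ‖E‖ * ‖T u‖ ≤ K₀ * ε₂ * ‖T u‖ := by gcongr
    have h4 : K₃ * ‖u + correction S φ u‖ ^ 2 * ‖T u‖
        ≤ K₃ * ((1 + γ₁ * γ₂) * R) ^ 2 * ‖T u‖ := by
      gcongr
      exact norm_add_correction_le hfr hu
    have h5 : (-toDual ι κ E - N (u + correction S φ u)) (T u)
        = -toDual ι κ E (T u) - N (u + correction S φ u) (T u) := rfl
    rw [h5]
    linarith [(abs_le.1 h1).1, (abs_le.1 h2).1]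
  have hlip : ∀ u v, ‖u‖ ≤ R → ‖v‖ ≤ R → ‖T u - T v‖
      ≤ |Q| * ((1 + γ₁ * γ₂) * R + (1 + γ₁ * γ₂) * R) * D * ‖ι‖ / a * ‖ι u - ι v‖ :=
    fun u v hu hv => by
    rw [div_mul_eq_mul_div, le_div_iff₀' hpos]
    refine hdiv _ _ (by positivity) ((hcoer _).trans ?_)
    set u' := u + correction S φ u
    set v' := v + correction S φ v
    have hdiff : mainOp ι κ L₁ L₂ S ψ r (T u - T v) = -(N u' - N v') := by
      rw [map_sub, hT, hT]; abel
    have hι : ‖ι u' - ι v'‖ ≤ D * ‖ι u - ι v‖ := by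
      have := hD (u - v)
      rwa [correction_sub, sub_add_sub_comm, map_sub, map_sub] at this
    rw [hdiff]
    calc (-(N u' - N v')) (T u - T v) ≤ |(N u' - N v') (T u - T v - 0)| := by
          rw [sub_zero]; exact neg_le_abs _
      _ ≤ Q * (‖u'‖ + ‖v'‖) * ‖ι u' - ι v'‖ * ‖ι (T u - T v) - ι 0‖ := hQ _ _ _ _
      _ ≤ |Q| * ((1 + γ₁ * γ₂) * R + (1 + γ₁ * γ₂) * R) * (D * ‖ι u - ι v‖)
            * (‖ι‖ * ‖T u - T v‖) := by
          rw [map_zero, sub_zero]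
          gcongr
          · exact le_abs_self Q
          · exact norm_add_correction_le hfr hu
          · exact norm_add_correction_le hfr hv
          · exact ι.le_opNorm _
      _ = _ := by ring
  obtain ⟨w, hw, hTw⟩ := exists_fixedPoint_of_compact e hL.compact_ι hR hball hlip
  refine ⟨w, hw, ?_⟩
  have := hT w
  rwa [hTw] at this

end Existence

end AbstractExistence

theorem theorem3
    {H0 H1 B W : Type*}
    [NormedAddCommGroup H0] [InnerProductSpace ℝ H0] [CompleteSpace H0]
    [NormedAddCommGroup H1] [NormedSpace ℝ H1] [CompleteSpace H1]
    [NormedAddCommGroup B] [NormedSpace ℝ B]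
    [AddTorsor H1 W]
    (ι : H1 →L[ℝ] B) (κ : B →L[ℝ] H0)
    (L₁ : H1 →ₗ[ℝ] StrongDual ℝ H1) (L₂ : H0 →ₗ[ℝ] H0)
    (N : H1 → StrongDual ℝ H1) (E : H0)
    -- the nonlinear equation `J = 0` on the affine space `W = wbar + H1`, expanded around `wbar`
    (J : W → StrongDual ℝ H1) (wbar : W)
    (hJ : ∀ w : H1, J (w +ᵥ wbar) =
      AbstractExistence.fullOp ι κ L₁ L₂ w + N w + AbstractExistence.toDual ι κ E)
    (n : ℕ) (S : H1 →ₗ[ℝ] EuclideanSpace ℝ (Fin n))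
    (ψ : Fin n → H0) (φ : Fin n → H1) (r : Fin n → H0)
    (K₀ K₁ K₂ K₃ δ₁ ε₁ ε₂ γ₁ γ₂ : ℝ)
    (hL : AbstractExistence.AprioriBounds ι κ L₁ L₂ K₀ K₁ K₂)
    (hfr : AbstractExistence.FiniteRankApproximation ι κ L₁ L₂ S ψ φ r δ₁ ε₁ γ₁ γ₂)
    (hE : ‖E‖ ≤ ε₂)
    (hN : AbstractExistence.NonlinearEstimate ι N K₃)
    (hpos : 0 < AbstractExistence.coercConst K₀ K₁ K₂ δ₁ ε₁ γ₁)
    (hM₄ : 0 ≤ AbstractExistence.M₄ K₀ K₁ K₂ K₃ δ₁ ε₁ ε₂ γ₁ γ₂) :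
    ∃ w₁ w₂ : H1,
      w₂ = AbstractExistence.correction S φ w₁ ∧
      -- the system for `(w₁, w₂)`
      L₁ w₁ + AbstractExistence.toDual ι κ (AbstractExistence.residualOp ι κ L₂ S ψ r w₁) =
        -AbstractExistence.toDual ι κ E - N (w₁ + w₂) ∧
      AbstractExistence.fullOp ι κ L₁ L₂ w₂ =
        -AbstractExistence.toDual ι κ (AbstractExistence.finiteRankOp L₂ S ψ r w₁) ∧
      ‖w₁‖ ≤ AbstractExistence.radius K₀ K₁ K₂ K₃ δ₁ ε₁ ε₂ γ₁ γ₂ ∧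
      -- the resulting solution of the error equation and of the original equation
      AbstractExistence.fullOp ι κ L₁ L₂ (w₁ + w₂) + N (w₁ + w₂) +
        AbstractExistence.toDual ι κ E = 0 ∧
      ∃ wtilde : W, wtilde = (w₁ + w₂) +ᵥ wbar ∧ J wtilde = 0 ∧
        ‖wbar -ᵥ wtilde‖ ≤
          (1 + γ₁ * γ₂) * AbstractExistence.radius K₀ K₁ K₂ K₃ δ₁ ε₁ ε₂ γ₁ γ₂ := by
  obtain ⟨w₁, hw₁, h₁⟩ := AbstractExistence.exists_mainOp_eq hL hfr hE hN hpos hM₄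
  have hG := AbstractExistence.fullOp_correction hfr w₁
  have hsum : AbstractExistence.fullOp ι κ L₁ L₂ (w₁ + AbstractExistence.correction S φ w₁) +
      N (w₁ + AbstractExistence.correction S φ w₁) + AbstractExistence.toDual ι κ E = 0 := by
    -- `L w₁ - L_ap w₁ = L₁ w₁ + L_res w₁`
    have hsplit : AbstractExistence.fullOp ι κ L₁ L₂ w₁ =
        AbstractExistence.mainOp ι κ L₁ L₂ S ψ r w₁ +
          AbstractExistence.toDual ι κ (AbstractExistence.finiteRankOp L₂ S ψ r w₁) := by
      ext g
      change L₁ w₁ g + inner ℝ _ _ = L₁ w₁ g + inner ℝ (_ - _) _ + inner ℝ _ _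
      rw [inner_sub_left]
      ring
    rw [AbstractExistence.fullOp_add, hG, hsplit, h₁]
    abel
  refine ⟨w₁, _, rfl, h₁, hG, hw₁, hsum, _, rfl, by rw [hJ, hsum], ?_⟩
  rw [vsub_vadd_eq_vsub_sub, vsub_self, zero_sub, norm_neg]
  exact AbstractExistence.norm_add_correction_le hfr hw₁
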